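/- Let $\mathcal H$ and $\mathcal K$ be finite-dimensional complex Hilbert spaces, let $N=\dim\mathcal H\ge 1$, and let $U$ be a unitary operator on $\mathcal H\otimes\mathcal K$. For $f,g\in\mathcal H$ and an operator $T$ on $\mathcal H\otimes\mathcal K$, let $T(f,g)$ be the operator on $\mathcal K$ determined by $\langle\varphi, T(f,g)\psi\rangle=\langle f\otimes\varphi, T(g\otimes\psi)\rangle$ for all $\varphi,\psi\in\mathcal K$ (that is, $T(f,g)=\mathrm{Tr}_{|g\rangle\langle f|}[T]$). For a set $\mathcal S\subset\mathcal B(\mathcal K)$ let $\mathcal S'$ denote its commutant in $\mathcal B(\mathcal K)$, and put $$\mathcal A(U)=\{U(f,g),\,U^*(f,g)\;:\;f,g\in\mathcal H\}'',\qquad \mathcal A_r(U)=\{U^*(f_1,g_1)\,U(f_2,g_2)\;:\;f_1,g_1,f_2,g_2\in\mathcal H\}''.$$ With $\mathrm{Tr}_{\mathcal H}:\mathcal B(\mathcal H\otimes\mathcal K)\to\mathcal B(\mathcal K)$ the partial trace over $\mathcal H$, define for $X\in\mathcal B(\mathcal K)$ $$\mathcal L(X)=\mathrm{Tr}_{\mathcal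 H}\!\left[U\left(\tfrac1N I_{\mathcal H}\otimes X\right)U^*\right],\qquad \mathcal L^*(X)=\mathrm{Tr}_{\mathcal H}\!\left[U^*\left(\tfrac1N I_{\mathcal H}\otimes X\right)U\right].$$ Then $\mathcal L^*$ is the adjoint of $\mathcal L$ for the Hilbert–Schmidt scalar product $(X,Y)\mapsto\mathrm{Tr}[X^*Y]$ on $\mathcal B(\mathcal K)$, and: 1. $\mathcal A(U)'=\{X\in\mathcal B(\mathcal K):\mathcal L(X)=X\}=\{X\in\mathcal B(\mathcal K):\mathcal L^*(X)=X\}$, i.e. $\mathcal A(U)'$ is the eigenspace of $\mathcal L$, and also the eigenspace of $\mathcal L^*$, for the eigenvalue $1$; 2. $\mathcal A_r(U)'$ is the right-singular space of $\mathcal L$ for the singular value $1$, i.e. $\mathcal A_r(U)'=\{X\in\mathcal B(\mathcal K):\text{there is }X'\in\mathcal B(\mathcal K)\text{ with }\mathcal L(X)=X'\text{ and }\mathcal L^*(X')=X\}$. -/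

import Mathlib

open scoped TensorProduct

noncomputable section

namespace EnvAlg

variable {H K : Type*}
  [NormedAddCommGroup H] [InnerProductSpace ℂ H] [FiniteDimensional ℂ H]
  [NormedAddCommGroup K] [InnerProductSpace ℂ K] [FiniteDimensional ℂ K]

/-- The weighted partial trace `Tr_ω` over `H`: the linear map `B(H ⊗ K) → B(K)` which sends
`A ⊗ B` to `Tr[ω A] B`. -/
def partialTraceAgainst (ω : H →ₗ[ℂ] H) :
    ((H ⊗[ℂ] K) →ₗ[ℂ] (H ⊗[ℂ] K)) →ₗ[ℂ] (K →ₗ[ℂ] K) :=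
  (TensorProduct.lid ℂ (K →ₗ[ℂ] K)).toLinearMap ∘ₗ
    LinearMap.rTensor (K →ₗ[ℂ] K) (LinearMap.trace ℂ H ∘ₗ LinearMap.mulLeft ℂ ω) ∘ₗ
      (homTensorHomEquiv ℂ H K H K).symm.toLinearMap

/-- The partial trace `Tr_H : B(H ⊗ K) → B(K)`. -/
def partialTrace : ((H ⊗[ℂ] K) →ₗ[ℂ] (H ⊗[ℂ] K)) →ₗ[ℂ] (K →ₗ[ℂ] K) :=
  partialTraceAgainst (1 : H →ₗ[ℂ] H)

theorem partialTraceAgainst_map (ω A : H →ₗ[ℂ] H) (B : K →ₗ[ℂ] K) :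
    partialTraceAgainst ω (TensorProduct.map A B) = LinearMap.trace ℂ H (ω * A) • B := by
  have h : TensorProduct.map A B = homTensorHomEquiv ℂ H K H K (A ⊗ₜ[ℂ] B) := by
    rw [homTensorHomEquiv_apply]; rfl
  unfold partialTraceAgainst
  rw [h, LinearMap.comp_apply, LinearMap.comp_apply, LinearEquiv.coe_toLinearMap,
    LinearEquiv.coe_toLinearMap, LinearEquiv.symm_apply_apply, LinearMap.rTensor_tmul,
    TensorProduct.lid_tmul]
  rfl

/-- The defining duality of the partial trace. -/
theorem trace_partialTraceAgainst_mul (ω : H →ₗ[ℂ] H)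
    (T : (H ⊗[ℂ] K) →ₗ[ℂ] (H ⊗[ℂ] K)) (Y : K →ₗ[ℂ] K) :
    LinearMap.trace ℂ K (partialTraceAgainst ω T * Y) =
      LinearMap.trace ℂ (H ⊗[ℂ] K) (T * TensorProduct.map ω Y) := by
  obtain ⟨t, rfl⟩ := (homTensorHomEquiv ℂ H K H K).surjective T
  induction t with
  | zero => simp
  | add x y hx hy => simp only [map_add, add_mul, hx, hy]
  | tmul A B =>
    have h : homTensorHomEquiv ℂ H K H K (A ⊗ₜ[ℂ] B) = TensorProduct.map A B := by
      rw [homTensorHomEquiv_apply]; rfl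
    rw [h, partialTraceAgainst_map, ← TensorProduct.map_mul, LinearMap.trace_tensorProduct',
      LinearMap.trace_mul_comm ℂ A ω]
    simp

/-- The operator `T(f, g) = Tr_{|g⟩⟨f|}[T]` on `K`. -/
def slice (T : (H ⊗[ℂ] K) →ₗ[ℂ] (H ⊗[ℂ] K)) (f g : H) : K →ₗ[ℂ] K :=
  partialTraceAgainst (InnerProductSpace.rankOne ℂ g f : H →L[ℂ] H).toLinearMap T

/-- The environment algebra `A(U) = {U(f, g), U*(f, g)}''`. -/
def envAlgebra (U : (H ⊗[ℂ] K) →ₗ[ℂ] (H ⊗[ℂ] K)) : Subalgebra ℂ (K →ₗ[ℂ] K) :=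
  Subalgebra.centralizer ℂ (Subalgebra.centralizer ℂ
    {Y : K →ₗ[ℂ] K | ∃ f g : H, Y = slice U f g ∨ Y = slice (star U) f g} : Set (K →ₗ[ℂ] K))

/-- The environment right-action algebra `A_r(U) = {U*(f₁, g₁) U(f₂, g₂)}''`. -/
def envRightActionAlgebra (U : (H ⊗[ℂ] K) →ₗ[ℂ] (H ⊗[ℂ] K)) : Subalgebra ℂ (K →ₗ[ℂ] K) :=
  Subalgebra.centralizer ℂ (Subalgebra.centralizer ℂ
    {Y : K →ₗ[ℂ] K | ∃ f₁ g₁ f₂ g₂ : H, Y = slice (star U) f₁ g₁ * slice U f₂ g₂} :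
      Set (K →ₗ[ℂ] K))

/-- The commutant `A'`, as a linear subspace of `B(K)`. -/
def commutant (A : Subalgebra ℂ (K →ₗ[ℂ] K)) : Submodule ℂ (K →ₗ[ℂ] K) :=
  Subalgebra.toSubmodule (Subalgebra.centralizer ℂ (A : Set (K →ₗ[ℂ] K)))

/-- `L(X) = Tr_H[U ((1/N) I ⊗ X) U*]`, where `N = dim H`. -/
def cpMap (U : (H ⊗[ℂ] K) →ₗ[ℂ] (H ⊗[ℂ] K)) : (K →ₗ[ℂ] K) →ₗ[ℂ] (K →ₗ[ℂ] K) where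
  toFun X := partialTrace
    (U * TensorProduct.map ((1 / (Module.finrank ℂ H : ℂ)) • (1 : H →ₗ[ℂ] H)) X * star U)
  map_add' X Y := by simp [TensorProduct.map_add_right, mul_add, add_mul]
  map_smul' c X := by
    rw [TensorProduct.map_smul_right, mul_smul_comm, smul_mul_assoc, map_smul, RingHom.id_apply]

/-- `L*(X) = Tr_H[U* ((1/N) I ⊗ X) U]`, where `N = dim H`. -/
def cpMapStar (U : (H ⊗[ℂ] K) →ₗ[ℂ] (H ⊗[ℂ] K)) : (K →ₗ[ℂ] K) →ₗ[ℂ] (K →ₗ[ℂ] K) where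
  toFun X := partialTrace
    (star U * TensorProduct.map ((1 / (Module.finrank ℂ H : ℂ)) • (1 : H →ₗ[ℂ] H)) X * U)
  map_add' X Y := by simp [TensorProduct.map_add_right, mul_add, add_mul]
  map_smul' c X := by
    rw [TensorProduct.map_smul_right, mul_smul_comm, smul_mul_assoc, map_smul, RingHom.id_apply]

/-- `S` is the adjoint of `T` for the Hilbert–Schmidt scalar product `(X, Y) ↦ Tr[X* Y]`. -/
def IsHSAdjoint (T S : (K →ₗ[ℂ] K) →ₗ[ℂ] (K →ₗ[ℂ] K)) : Prop :=
  ∀ X Y : K →ₗ[ℂ] K,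
    LinearMap.trace ℂ K (star (T X) * Y) = LinearMap.trace ℂ K (star X * S Y)

/-- The right-singular space of `T`, with adjoint `S`, for the singular value `σ`: all `X` for
which some `X'` satisfies `T X = σ X'` and `S X' = σ X`. -/
def rightSingularSpace (T S : (K →ₗ[ℂ] K) →ₗ[ℂ] (K →ₗ[ℂ] K)) (σ : ℝ) :
    Submodule ℂ (K →ₗ[ℂ] K) where
  carrier := {X | ∃ X' : K →ₗ[ℂ] K, T X = (σ : ℂ) • X' ∧ S X' = (σ : ℂ) • X}
  zero_mem' := ⟨0, by simp⟩
  add_mem' := by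
    rintro X Y ⟨X', h₁, h₂⟩ ⟨Y', h₃, h₄⟩
    exact ⟨X' + Y', by rw [map_add, h₁, h₃, smul_add], by rw [map_add, h₂, h₄, smul_add]⟩
  smul_mem' := by
    rintro c X ⟨X', h₁, h₂⟩
    exact ⟨c • X', by rw [map_smul, h₁, smul_comm], by rw [map_smul, h₂, smul_comm]⟩

end EnvAlg

end

namespace EnvAlg

open InnerProductSpace

/-! Everything reduces to the intertwining relation `U (1 ⊗ X) = (1 ⊗ Y) U`. Slice by slice it reads
`U(f, g) X = Y U(f, g)`, so `Y = X` describes the commutant of `A(U)`, while an arbitrary `Y`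
describes that of `A_r(U)`. On the analytic side, `L` is the isometry `X ↦ N^{-1/2} (1 ⊗ X)`,
followed by conjugation by `U`, followed by the adjoint of that isometry. Hence `L` is a
Hilbert–Schmidt contraction, and `L` preserves the norm of `X` only if `U (1 ⊗ X) U* = 1 ⊗ L X`
(`intertwines_of_trace_cpMap_eq`). Both `L X = X` and `L* L X = X` force norm preservation;
conversely, intertwining gives `L X = Y` and `L* Y = X`. -/

/-- Since `S''' = S'`, only the generators need testing. -/
theorem mem_commutant_bicommutant_iff {K : Type*} [NormedAddCommGroup K]
    [InnerProductSpace ℂ K] (S : Set (K →ₗ[ℂ] K)) (X : K →ₗ[ℂ] K) :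
    X ∈ commutant (Subalgebra.centralizer ℂ (Subalgebra.centralizer ℂ S : Set (K →ₗ[ℂ] K))) ↔
      ∀ Y ∈ S, Y * X = X * Y := by
  change X ∈ S.centralizer.centralizer.centralizer ↔ _
  rw [Set.centralizer_centralizer_centralizer, Set.mem_centralizer_iff]

variable {H K : Type*}
  [NormedAddCommGroup H] [InnerProductSpace ℂ H] [FiniteDimensional ℂ H]
  [NormedAddCommGroup K] [InnerProductSpace ℂ K] [FiniteDimensional ℂ K]

/-- A property of operators on `H ⊗ K` holds for all of them if it is additive and holds for the
elementary tensors `A ⊗ B`. -/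
theorem end_tensor_induction {P : ((H ⊗[ℂ] K) →ₗ[ℂ] (H ⊗[ℂ] K)) → Prop}
    (map : ∀ (A : H →ₗ[ℂ] H) (B : K →ₗ[ℂ] K), P (TensorProduct.map A B))
    (add : ∀ S T, P S → P T → P (S + T)) (T : (H ⊗[ℂ] K) →ₗ[ℂ] (H ⊗[ℂ] K)) : P T := by
  obtain ⟨t, rfl⟩ := (homTensorHomEquiv ℂ H K H K).surjective T
  induction t with
  | zero =>
    have h := map 0 0
    rw [TensorProduct.map_zero_left] at h
    rwa [map_zero]
  | add x y hx hy => rw [map_add]; exact add _ _ hx hy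
  | tmul A B =>
    have h : homTensorHomEquiv ℂ H K H K (A ⊗ₜ[ℂ] B) = TensorProduct.map A B := by
      rw [homTensorHomEquiv_apply]; rfl
    rw [h]; exact map A B

/-! The general lemmas about `star` do not rewrite on `H ⊗ K` directly, since their additive
structure comes from the inner product space `H ⊗ K`. -/

theorem star_star_tensor (T : (H ⊗[ℂ] K) →ₗ[ℂ] (H ⊗[ℂ] K)) : star (star T) = T :=
  star_star T

theorem star_add_tensor (S T : (H ⊗[ℂ] K) →ₗ[ℂ] (H ⊗[ℂ] K)) : star (S + T) = star S + star T :=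
  star_add S T

theorem star_mul_tensor (S T : (H ⊗[ℂ] K) →ₗ[ℂ] (H ⊗[ℂ] K)) : star (S * T) = star T * star S :=
  star_mul S T

theorem star_tensor_map (A : H →ₗ[ℂ] H) (B : K →ₗ[ℂ] K) :
    star (TensorProduct.map A B) = TensorProduct.map (star A) (star B) := by
  simp only [LinearMap.star_eq_adjoint, TensorProduct.adjoint_map]

theorem star_one_tensor_map (X : K →ₗ[ℂ] K) :
    star (TensorProduct.map (1 : H →ₗ[ℂ] H) X) = TensorProduct.map 1 (star X) := by
  rw [star_tensor_map, star_one]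

theorem trace_star_eq {E : Type*} [NormedAddCommGroup E] [InnerProductSpace ℂ E]
    [FiniteDimensional ℂ E] (A : E →ₗ[ℂ] E) :
    LinearMap.trace ℂ E (star A) = star (LinearMap.trace ℂ E A) := by
  rw [LinearMap.trace_eq_sum_inner _ (stdOrthonormalBasis ℂ E),
    LinearMap.trace_eq_sum_inner _ (stdOrthonormalBasis ℂ E), star_sum]
  refine Finset.sum_congr rfl fun i _ => ?_
  rw [LinearMap.star_eq_adjoint, LinearMap.adjoint_inner_right]
  exact (inner_conj_symm _ _).symm

theorem eq_zero_of_trace_star_mul_self {E : Type*} [NormedAddCommGroup E]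
    [InnerProductSpace ℂ E] [FiniteDimensional ℂ E] {A : E →ₗ[ℂ] E}
    (h : LinearMap.trace ℂ E (star A * A) = 0) : A = 0 := by
  set b := stdOrthonormalBasis ℂ E
  have hs : LinearMap.trace ℂ E (star A * A) = ((∑ i, ‖A (b i)‖ ^ 2 : ℝ) : ℂ) := by
    rw [LinearMap.trace_eq_sum_inner _ b, Complex.ofReal_sum]
    refine Finset.sum_congr rfl fun i _ => ?_
    rw [Module.End.mul_apply, LinearMap.star_eq_adjoint, LinearMap.adjoint_inner_right,
      inner_self_eq_norm_sq_to_K]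
    simp
  rw [hs, Complex.ofReal_eq_zero, Finset.sum_eq_zero_iff_of_nonneg fun i _ => by positivity] at h
  refine b.toBasis.ext fun i => ?_
  simpa using h i (Finset.mem_univ i)

/-! ### Slices as matrix entries over `H` -/

section Slice

theorem slice_map (A : H →ₗ[ℂ] H) (B : K →ₗ[ℂ] K) (f g : H) :
    slice (TensorProduct.map A B) f g = inner ℂ f (A g) • B := by
  have h : A * (rankOne ℂ g f : H →L[ℂ] H).toLinearMap =
      (rankOne ℂ (A g) f : H →L[ℂ] H).toLinearMap := by
    ext x; simp
  rw [slice, partialTraceAgainst_map, LinearMap.trace_mul_comm, h, trace_rankOne]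

theorem slice_add (S T : (H ⊗[ℂ] K) →ₗ[ℂ] (H ⊗[ℂ] K)) (f g : H) :
    slice (S + T) f g = slice S f g + slice T f g := map_add _ _ _

theorem inner_slice (T : (H ⊗[ℂ] K) →ₗ[ℂ] (H ⊗[ℂ] K)) (f g : H) (φ ψ : K) :
    inner ℂ φ (slice T f g ψ) = inner ℂ (f ⊗ₜ[ℂ] φ) (T (g ⊗ₜ[ℂ] ψ)) := by
  induction T using end_tensor_induction with
  | map A B => simp [slice_map]
  | add S T hS hT => simp only [slice_add, LinearMap.add_apply, inner_add_right, hS, hT]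

theorem ext_slice {S T : (H ⊗[ℂ] K) →ₗ[ℂ] (H ⊗[ℂ] K)}
    (h : ∀ f g, slice S f g = slice T f g) : S = T := by
  refine TensorProduct.ext' fun g ψ => ?_
  rw [TensorProduct.ext_iff_inner_left]
  intro f φ
  rw [← inner_slice, ← inner_slice, h]

theorem slice_mul_one_map (T : (H ⊗[ℂ] K) →ₗ[ℂ] (H ⊗[ℂ] K)) (X : K →ₗ[ℂ] K) (f g : H) :
    slice (T * TensorProduct.map 1 X) f g = slice T f g * X := by
  induction T using end_tensor_induction with
  | map A B => rw [← TensorProduct.map_mul, slice_map, slice_map, mul_one, smul_mul_assoc]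
  | add S T hS hT => rw [add_mul, slice_add, slice_add, add_mul, hS, hT]

theorem slice_one_map_mul (T : (H ⊗[ℂ] K) →ₗ[ℂ] (H ⊗[ℂ] K)) (X : K →ₗ[ℂ] K) (f g : H) :
    slice (TensorProduct.map 1 X * T) f g = X * slice T f g := by
  induction T using end_tensor_induction with
  | map A B => rw [← TensorProduct.map_mul, slice_map, slice_map, one_mul, mul_smul_comm]
  | add S T hS hT => rw [mul_add, slice_add, slice_add, mul_add, hS, hT]

/-- This makes the generators of `A_r(U)` the slices of `U* (|a⟩⟨b| ⊗ 1) U`. -/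
theorem slice_mul_rankOne_mul (S T : (H ⊗[ℂ] K) →ₗ[ℂ] (H ⊗[ℂ] K)) (a b f g : H) :
    slice (S * TensorProduct.map (rankOne ℂ a b : H →L[ℂ] H).toLinearMap 1 * T) f g =
      slice S f a * slice T b g := by
  induction S using end_tensor_induction with
  | add S S' hS hS' => simp only [add_mul, slice_add, hS, hS']
  | map A B =>
    induction T using end_tensor_induction with
    | add T T' hT hT' => simp only [mul_add, slice_add, hT, hT']
    | map C D =>
      rw [← TensorProduct.map_mul, ← TensorProduct.map_mul, slice_map, slice_map, slice_map,
        mul_one, smul_mul_smul_comm]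
      congr 1
      simp [mul_comm]

theorem slice_one (f g : H) :
    slice (1 : (H ⊗[ℂ] K) →ₗ[ℂ] (H ⊗[ℂ] K)) f g = inner ℂ f g • 1 := by
  rw [← TensorProduct.map_one, slice_map, Module.End.one_apply]

/-- An operator which commutes with `B(H) ⊗ 1` is of the form `1 ⊗ Y`. -/
theorem exists_eq_one_map_of_commute [Nontrivial H] {T : (H ⊗[ℂ] K) →ₗ[ℂ] (H ⊗[ℂ] K)}
    (h : ∀ a b : H, Commute T
      (TensorProduct.map (rankOne ℂ a b : H →L[ℂ] H).toLinearMap (1 : K →ₗ[ℂ] K))) :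
    ∃ Y : K →ₗ[ℂ] K, T = TensorProduct.map 1 Y := by
  obtain ⟨e, he⟩ := exists_norm_eq H zero_le_one
  refine ⟨slice T e e, ext_slice fun f a => ?_⟩
  -- Comparing the `(f, e)` slices of `T (|a⟩⟨e| ⊗ 1)` and `(|a⟩⟨e| ⊗ 1) T` gives `T(f, a) = ⟨f, a⟩
  -- T(e, e)`.
  have h₁ := slice_mul_rankOne_mul T 1 a e f e
  have h₂ := slice_mul_rankOne_mul 1 T a e f e
  rw [mul_one, (h a e).eq] at h₁
  rw [one_mul, h₁, slice_one, slice_one, inner_self_eq_norm_sq_to_K, he] at h₂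
  rw [slice_map, Module.End.one_apply]
  simpa using h₂

/-- `T (1 ⊗ X) = (1 ⊗ Y) T` may be tested on slices. -/
theorem mul_one_map_eq_iff (T : (H ⊗[ℂ] K) →ₗ[ℂ] (H ⊗[ℂ] K)) (X Y : K →ₗ[ℂ] K) :
    T * TensorProduct.map 1 X = TensorProduct.map 1 Y * T ↔
      ∀ f g, slice T f g * X = Y * slice T f g := by
  refine ⟨fun h f g => ?_, fun h => ext_slice fun f g => ?_⟩
  · rw [← slice_mul_one_map, h, slice_one_map_mul]
  · rw [slice_mul_one_map, h, slice_one_map_mul]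

end Slice

/-! ### Partial trace and the Hilbert–Schmidt norm -/

section PartialTrace

theorem partialTrace_map (A : H →ₗ[ℂ] H) (B : K →ₗ[ℂ] K) :
    partialTrace (TensorProduct.map A B) = LinearMap.trace ℂ H A • B := by
  rw [partialTrace, partialTraceAgainst_map, one_mul]

theorem trace_partialTrace_mul (T : (H ⊗[ℂ] K) →ₗ[ℂ] (H ⊗[ℂ] K)) (Y : K →ₗ[ℂ] K) :
    LinearMap.trace ℂ K (partialTrace T * Y) =
      LinearMap.trace ℂ (H ⊗[ℂ] K) (T * TensorProduct.map 1 Y) :=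
  trace_partialTraceAgainst_mul 1 T Y

theorem star_partialTrace (T : (H ⊗[ℂ] K) →ₗ[ℂ] (H ⊗[ℂ] K)) :
    star (partialTrace T) = partialTrace (star T) := by
  induction T using end_tensor_induction with
  | map A B => rw [star_tensor_map, partialTrace_map, partialTrace_map, star_smul, trace_star_eq]
  | add S T hS hT => rw [map_add, star_add, star_add_tensor, map_add, hS, hT]

theorem trace_one_map (Y : K →ₗ[ℂ] K) :
    LinearMap.trace ℂ (H ⊗[ℂ] K) (TensorProduct.map 1 Y) =
      (Module.finrank ℂ H : ℂ) * LinearMap.trace ℂ K Y := by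
  rw [LinearMap.trace_tensorProduct', LinearMap.trace_one]

/-- The equality case of the contractivity of the partial trace: `N^{-1/2} Tr_H` is the adjoint of
the isometry `Y ↦ N^{-1/2} (1 ⊗ Y)` for the Hilbert–Schmidt scalar products. -/
theorem eq_one_map_of_trace_eq {T : (H ⊗[ℂ] K) →ₗ[ℂ] (H ⊗[ℂ] K)} {Y : K →ₗ[ℂ] K}
    (hT : partialTrace T = (Module.finrank ℂ H : ℂ) • Y)
    (h : LinearMap.trace ℂ (H ⊗[ℂ] K) (star T * T) =
      (Module.finrank ℂ H : ℂ) * LinearMap.trace ℂ K (star Y * Y)) :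
    T = TensorProduct.map 1 Y := by
  have h₁ : LinearMap.trace ℂ (H ⊗[ℂ] K) (star T * TensorProduct.map 1 Y) =
      (Module.finrank ℂ H : ℂ) * LinearMap.trace ℂ K (star Y * Y) := by
    rw [← trace_partialTrace_mul, ← star_partialTrace, hT, star_smul, smul_mul_assoc, map_smul]
    simp
  have h₂ : LinearMap.trace ℂ (H ⊗[ℂ] K) (TensorProduct.map 1 (star Y) * T) =
      (Module.finrank ℂ H : ℂ) * LinearMap.trace ℂ K (star Y * Y) := by
    rw [LinearMap.trace_mul_comm, ← trace_partialTrace_mul, hT, smul_mul_assoc, map_smul,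
      LinearMap.trace_mul_comm, smul_eq_mul]
  -- All four terms of the expanded `‖T - 1 ⊗ Y‖²` equal `N Tr[Y* Y]` up to sign, and they cancel.
  refine sub_eq_zero.mp (eq_zero_of_trace_star_mul_self ?_)
  rw [star_sub, star_one_tensor_map, sub_mul, mul_sub, mul_sub, ← TensorProduct.map_mul, one_mul,
    map_sub, map_sub, map_sub, h, h₁, h₂, trace_one_map]
  ring

end PartialTrace

theorem cpMap_apply (U : (H ⊗[ℂ] K) →ₗ[ℂ] (H ⊗[ℂ] K)) (X : K →ₗ[ℂ] K) :
    cpMap U X = (1 / (Module.finrank ℂ H : ℂ)) •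
      partialTrace (U * TensorProduct.map 1 X * star U) := by
  change partialTrace _ = _
  rw [TensorProduct.map_smul_left, mul_smul_comm, smul_mul_assoc, map_smul]

theorem cpMapStar_eq (U : (H ⊗[ℂ] K) →ₗ[ℂ] (H ⊗[ℂ] K)) : cpMapStar U = cpMap (star U) := by
  ext1 X
  change partialTrace _ = partialTrace _
  rw [star_star_tensor]

theorem isHSAdjoint_cpMap (U : (H ⊗[ℂ] K) →ₗ[ℂ] (H ⊗[ℂ] K)) :
    IsHSAdjoint (cpMap U) (cpMapStar U) := by
  intro X Y
  rw [cpMapStar_eq, cpMap_apply, cpMap_apply, star_smul, star_partialTrace, star_mul_tensor,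
    star_mul_tensor, star_one_tensor_map, smul_mul_assoc, mul_smul_comm, map_smul, map_smul,
    trace_partialTrace_mul, LinearMap.trace_mul_comm ℂ (star X), trace_partialTrace_mul,
    star_star_tensor]
  congr 1
  · simp
  · rw [← mul_assoc, mul_assoc, LinearMap.trace_mul_comm]
    simp only [mul_assoc]

variable {U : (H ⊗[ℂ] K) →ₗ[ℂ] (H ⊗[ℂ] K)}

theorem conj_eq_iff (hU : U ∈ unitary ((H ⊗[ℂ] K) →ₗ[ℂ] (H ⊗[ℂ] K)))
    (S T : (H ⊗[ℂ] K) →ₗ[ℂ] (H ⊗[ℂ] K)) : U * S * star U = T ↔ U * S = T * U := by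
  constructor
  · rintro rfl
    rw [mul_assoc _ (star U), Unitary.star_mul_self_of_mem hU, mul_one]
  · intro h
    rw [h, mul_assoc, Unitary.mul_star_self_of_mem hU, mul_one]

/-- By unitarity, a relation for `U` yields the reversed one for `U*`, so the slices of `U*` impose
nothing new. -/
theorem star_intertwines (hU : U ∈ unitary ((H ⊗[ℂ] K) →ₗ[ℂ] (H ⊗[ℂ] K)))
    {S T : (H ⊗[ℂ] K) →ₗ[ℂ] (H ⊗[ℂ] K)} (h : U * S = T * U) : star U * T = S * star U := by
  rw [← (conj_eq_iff hU S T).mpr h, ← mul_assoc, ← mul_assoc, Unitary.star_mul_self_of_mem hU,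
    one_mul]

theorem trace_star_conj_mul_conj (hU : U ∈ unitary ((H ⊗[ℂ] K) →ₗ[ℂ] (H ⊗[ℂ] K)))
    (X : K →ₗ[ℂ] K) :
    LinearMap.trace ℂ (H ⊗[ℂ] K) (star (U * TensorProduct.map 1 X * star U) *
        (U * TensorProduct.map 1 X * star U)) =
      (Module.finrank ℂ H : ℂ) * LinearMap.trace ℂ K (star X * X) := by
  have h : star (U * TensorProduct.map 1 X * star U) * (U * TensorProduct.map 1 X * star U) =
      U * (TensorProduct.map 1 (star X * X) * star U) := by
    rw [star_mul_tensor, star_mul_tensor, star_star_tensor, star_one_tensor_map]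
    calc _ = U * (TensorProduct.map 1 (star X) * (star U * U) * TensorProduct.map 1 X * star U) := by
          simp only [mul_assoc]
      _ = _ := by
          rw [Unitary.star_mul_self_of_mem hU, mul_one, ← TensorProduct.map_mul, one_mul]
  rw [h, LinearMap.trace_mul_comm, mul_assoc, Unitary.star_mul_self_of_mem hU, mul_one,
    trace_one_map]

section Nontrivial

variable [Nontrivial H]

theorem finrank_cast_ne_zero : (Module.finrank ℂ H : ℂ) ≠ 0 :=
  Nat.cast_ne_zero.mpr Module.finrank_pos.ne'

theorem cpMap_eq_of_intertwines (hU : U ∈ unitary ((H ⊗[ℂ] K) →ₗ[ℂ] (H ⊗[ℂ] K)))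
    {X Y : K →ₗ[ℂ] K} (h : U * TensorProduct.map 1 X = TensorProduct.map 1 Y * U) :
    cpMap U X = Y := by
  rw [cpMap_apply, (conj_eq_iff hU _ _).mpr h, partialTrace_map, LinearMap.trace_one, smul_smul,
    one_div_mul_cancel finrank_cast_ne_zero, one_smul]

/-- If `L` preserves the Hilbert–Schmidt norm of `X`, then `U (1 ⊗ X) = (1 ⊗ L X) U`. -/
theorem intertwines_of_trace_cpMap_eq (hU : U ∈ unitary ((H ⊗[ℂ] K) →ₗ[ℂ] (H ⊗[ℂ] K)))
    {X : K →ₗ[ℂ] K} (h : LinearMap.trace ℂ K (star (cpMap U X) * cpMap U X) =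
      LinearMap.trace ℂ K (star X * X)) :
    U * TensorProduct.map 1 X = TensorProduct.map 1 (cpMap U X) * U := by
  rw [← conj_eq_iff hU]
  refine eq_one_map_of_trace_eq ?_ ?_
  · rw [cpMap_apply, smul_smul, mul_one_div_cancel finrank_cast_ne_zero, one_smul]
  · rw [trace_star_conj_mul_conj hU, h]

theorem mem_eigenspace_cpMap_iff (hU : U ∈ unitary ((H ⊗[ℂ] K) →ₗ[ℂ] (H ⊗[ℂ] K)))
    (X : K →ₗ[ℂ] K) : X ∈ Module.End.eigenspace (cpMap U) 1 ↔
      U * TensorProduct.map 1 X = TensorProduct.map 1 X * U := by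
  rw [Module.End.mem_eigenspace_iff, one_smul]
  refine ⟨fun h => ?_, cpMap_eq_of_intertwines hU⟩
  have := intertwines_of_trace_cpMap_eq hU (X := X) (by rw [h])
  rwa [h] at this

theorem mem_rightSingularSpace_iff (hU : U ∈ unitary ((H ⊗[ℂ] K) →ₗ[ℂ] (H ⊗[ℂ] K)))
    (X : K →ₗ[ℂ] K) : X ∈ rightSingularSpace (cpMap U) (cpMapStar U) 1 ↔
      ∃ Y : K →ₗ[ℂ] K, U * TensorProduct.map 1 X = TensorProduct.map 1 Y * U := by
  change (∃ Y, cpMap U X = ((1 : ℝ) : ℂ) • Y ∧ cpMapStar U Y = ((1 : ℝ) : ℂ) • X) ↔ _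
  simp only [Complex.ofReal_one, one_smul]
  constructor
  · rintro ⟨_, rfl, h⟩
    refine ⟨_, intertwines_of_trace_cpMap_eq hU ?_⟩
    -- `‖L X‖² = Tr[X* L* L X] = ‖X‖²`.
    rw [isHSAdjoint_cpMap, h]
  · rintro ⟨Y, h⟩
    refine ⟨Y, cpMap_eq_of_intertwines hU h, ?_⟩
    rw [cpMapStar_eq]
    exact cpMap_eq_of_intertwines (Unitary.star_mem hU) (star_intertwines hU h)

end Nontrivial

/-! ### Commutants as intertwining relations -/

theorem mem_commutant_envAlgebra_iff (hU : U ∈ unitary ((H ⊗[ℂ] K) →ₗ[ℂ] (H ⊗[ℂ] K)))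
    (X : K →ₗ[ℂ] K) : X ∈ commutant (envAlgebra U) ↔
      U * TensorProduct.map 1 X = TensorProduct.map 1 X * U := by
  rw [envAlgebra, mem_commutant_bicommutant_iff]
  constructor
  · intro h
    exact (mul_one_map_eq_iff U X X).mpr fun f g => h _ ⟨f, g, Or.inl rfl⟩
  · rintro h _ ⟨f, g, rfl | rfl⟩
    · exact (mul_one_map_eq_iff U X X).mp h f g
    · exact (mul_one_map_eq_iff (star U) X X).mp (star_intertwines hU h) f g

theorem mem_commutant_envRightActionAlgebra_iff [Nontrivial H]
    (hU : U ∈ unitary ((H ⊗[ℂ] K) →ₗ[ℂ] (H ⊗[ℂ] K))) (X : K →ₗ[ℂ] K) :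
    X ∈ commutant (envRightActionAlgebra U) ↔
      ∃ Y : K →ₗ[ℂ] K, U * TensorProduct.map 1 X = TensorProduct.map 1 Y * U := by
  rw [envRightActionAlgebra, mem_commutant_bicommutant_iff]
  constructor
  · intro h
    simp only [← conj_eq_iff hU]
    -- `1 ⊗ X` commutes with `U* (B(H) ⊗ 1) U`; conjugating by `U`, `U (1 ⊗ X) U*` commutes with
    -- `B(H) ⊗ 1`.
    refine exists_eq_one_map_of_commute fun a b => ?_
    set E := TensorProduct.map (rankOne ℂ a b : H →L[ℂ] H).toLinearMap (1 : K →ₗ[ℂ] K)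
    have hE : star U * E * U * TensorProduct.map 1 X =
        TensorProduct.map 1 X * (star U * E * U) := by
      refine (mul_one_map_eq_iff _ X X).mpr fun f g => ?_
      rw [slice_mul_rankOne_mul]
      exact h _ ⟨_, _, _, _, rfl⟩
    have hUU := Unitary.mul_star_self_of_mem hU
    calc U * TensorProduct.map 1 X * star U * E
        = U * (TensorProduct.map 1 X * (star U * E * U)) * star U := by
          simp only [mul_assoc, hUU, mul_one]
      _ = U * star U * E * (U * TensorProduct.map 1 X * star U) := by
          rw [← hE]; simp only [mul_assoc]
      _ = E * (U * TensorProduct.map 1 X * star U) := by rw [hUU, one_mul]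
  · rintro ⟨Y, h⟩ _ ⟨f₁, g₁, f₂, g₂, rfl⟩
    -- The slice of `U` turns `X` into `Y`, and the slice of `U*` turns it back.
    rw [mul_assoc, (mul_one_map_eq_iff U X Y).mp h, ← mul_assoc,
      (mul_one_map_eq_iff (star U) Y X).mp (star_intertwines hU h), mul_assoc]

end EnvAlg

theorem theorem3p10 {H K : Type*}
    [NormedAddCommGroup H] [InnerProductSpace ℂ H] [FiniteDimensional ℂ H] [Nontrivial H]
    [NormedAddCommGroup K] [InnerProductSpace ℂ K] [FiniteDimensional ℂ K]
    (U : (H ⊗[ℂ] K) →ₗ[ℂ] (H ⊗[ℂ] K))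
    (hU : U ∈ unitary ((H ⊗[ℂ] K) →ₗ[ℂ] (H ⊗[ℂ] K))) :
    EnvAlg.IsHSAdjoint (EnvAlg.cpMap U) (EnvAlg.cpMapStar U) ∧
    (EnvAlg.commutant (EnvAlg.envAlgebra U) = Module.End.eigenspace (EnvAlg.cpMap U) 1 ∧
      EnvAlg.commutant (EnvAlg.envAlgebra U) = Module.End.eigenspace (EnvAlg.cpMapStar U) 1) ∧
    EnvAlg.commutant (EnvAlg.envRightActionAlgebra U) =
      EnvAlg.rightSingularSpace (EnvAlg.cpMap U) (EnvAlg.cpMapStar U) 1 := by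
  refine ⟨EnvAlg.isHSAdjoint_cpMap U, ⟨?_, ?_⟩, ?_⟩ <;> ext X
  · rw [EnvAlg.mem_commutant_envAlgebra_iff hU, EnvAlg.mem_eigenspace_cpMap_iff hU]
  · rw [EnvAlg.mem_commutant_envAlgebra_iff hU, EnvAlg.cpMapStar_eq,
      EnvAlg.mem_eigenspace_cpMap_iff (Unitary.star_mem hU)]
    refine ⟨EnvAlg.star_intertwines hU, fun h => ?_⟩
    simpa only [EnvAlg.star_star_tensor] using EnvAlg.star_intertwines (Unitary.star_mem hU) h
  · rw [EnvAlg.mem_commutant_envRightActionAlgebra_iff hU, EnvAlg.mem_rightSingularSpace_iff hU]
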